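/- Conventions. All norms of functions are $L^1$ norms with respect to Lebesgue measure. $\mathcal D_d$ is the set of all probability densities on $[0,1)^d$ (with respect to Lebesgue measure). For $b\ge 1$ and $1\le i\le b$ let $h_{1,b,i}(x)=b\,\mathbf 1\left(\frac{i-1}{b}\le x<\frac ib\right)$, and let $\mathcal H_{1,b}=\operatorname{Conv}\{h_{1,b,1},\dots,h_{1,b,b}\}$ be the set of histograms on $[0,1)$ with $b$ equal bins. For $d,b,k\ge1$ let $$\mathcal H_{d,b}^k=\left\{(x_1,\dots,x_d)\mapsto\sum_{i=1}^k w_i\prod_{j=1}^d f_{i,j}(x_j)\ :\ w_i\ge0,\ \sum_{i=1}^k w_i=1,\ f_{i,j}\in\mathcal H_{1,b}\right\}.$$ Theorem. Let $d\ge2$, and let $b=b(n)$ and $k=k(n)$ be sequences of natural numbers with $b\to\infty$, $k\to\infty$, $b\ge k$ for all sufficiently large $n$, and $n/(bk)\to0$ as $n\to\infty$. Then there is no sequence of estimators $V_n=V_n(X_1,\dots,X_n)$ with values in $\mathcal H_{d,b}^k$ (for all sufficiently large $n$) such that, for every $\varepsilon>0$, $$\sup_{p\in\mathcal D_d}P\left(\|V_n-p\|>3\min_{q\in\mathcal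 H_{d,b}^k}\|p-q\|+\varepsilon\right)\to0\qquad(n\to\infty),$$ where $X_1,\dots,X_n$ are independent and identically distributed with density $p$. Here an estimator is an arbitrary function of the sample, and $P$ is read as outer probability if the event is not measurable. -/

import Mathlib

open Filter Topology MeasureTheory
open scoped ENNReal

namespace NNTF

/-- The half-open unit cube `[0,1)^d`. -/
def unitCube (d : ℕ) : Set (Fin d → ℝ) :=
  Set.univ.pi fun _ => Set.Ico (0 : ℝ) 1

/-- `𝒟_d`: the probability densities on `[0,1)^d` with respect to the Lebesgue measure, as
functions on `ℝ^d` that vanish off the cube. -/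
def densities (d : ℕ) : Set ((Fin d → ℝ) → ℝ) :=
  {p | Measurable p ∧ (∀ x, 0 ≤ p x) ∧ (∀ x, x ∉ unitCube d → p x = 0) ∧
    ∫⁻ x, ENNReal.ofReal (p x) = 1}

/-- The measure on `ℝ^d` that has the density `p`. -/
noncomputable def law {d : ℕ} (p : (Fin d → ℝ) → ℝ) : Measure (Fin d → ℝ) :=
  volume.withDensity fun x => ENNReal.ofReal (p x)

/-- The joint law of an i.i.d. sample of size `n` from the density `p`. -/
noncomputable def sampleLaw {d : ℕ} (n : ℕ) (p : (Fin d → ℝ) → ℝ) :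
    Measure (Fin n → Fin d → ℝ) :=
  Measure.pi fun _ : Fin n => law p

/-- The `L¹` distance `‖f - g‖`. -/
noncomputable def l1dist {d : ℕ} (f g : (Fin d → ℝ) → ℝ) : ℝ≥0∞ :=
  ∫⁻ x, ENNReal.ofReal |f x - g x|

/-- The one-dimensional histogram with all its weight in one of the `b` bins of `[0,1)`; the bins
are indexed from `0`, so that bin `i` is `[i / b, (i + 1) / b)`. -/
noncomputable def binHist (b : ℕ) (i : Fin b) : ℝ → ℝ :=
  (Set.Ico ((i : ℝ) / (b : ℝ)) (((i : ℝ) + 1) / (b : ℝ))).indicator fun _ => (b : ℝ)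

/-- `ℋ_{1,b}`: the one-dimensional histograms with `b` bins. -/
def histograms1 (b : ℕ) : Set (ℝ → ℝ) :=
  convexHull ℝ (Set.range (binHist b))

/-- `ℋ_{d,b}^k`: the `d`-dimensional histograms with `b` bins per dimension that are convex
combinations of `k` separable ones. -/
def multiViewHistograms (d b k : ℕ) : Set ((Fin d → ℝ) → ℝ) :=
  {g | ∃ w ∈ stdSimplex ℝ (Fin k), ∃ f : Fin k → Fin d → ℝ → ℝ,
    (∀ i j, f i j ∈ histograms1 b) ∧ g = fun x => ∑ i, w i * ∏ j, f i j (x j)}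

/-- The worst-case probability, over all densities `p` on `[0,1)^d`, that the estimator `V` of a
sample of size `n` has `‖V - p‖ > 3 min_{q ∈ Q} ‖p - q‖ + ε`. -/
noncomputable def worstFailureProb {d n : ℕ} (V : (Fin n → Fin d → ℝ) → (Fin d → ℝ) → ℝ)
    (Q : Set ((Fin d → ℝ) → ℝ)) (ε : ℝ) : ℝ≥0∞ :=
  ⨆ p ∈ densities d,
    sampleLaw n p {x | l1dist (V x) p > 3 * (⨅ q ∈ Q, l1dist p q) + ENNReal.ofReal ε}

end NNTF

namespace NNTF

/-! Two-point indistinguishability, averaged over a hypercube. Take `N = k * (b / 2)` disjoint pairs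
of grid cells; for each choice `θ` of one cell per pair, the uniform mixture of the chosen cells
lies in the class (`cellMixture_pairedCell_mem`), so its approximation error is `0` and the factor 3
is harmless. If `2 * n ≤ N`, every sample misses at least half of the pairs. Flipping `θ` on the
missed pairs keeps the likelihood but moves the density by at least `1 / 2` in `L¹`, so no estimate
is within `1 / 8` of both densities. Averaging over `θ` (`card_le_two_mul_sum_measure`), some
mixture has failure probability at least `1 / 2`; `n / (bk) → 0` eventually forces `2 * n ≤ N`. -/

/-! ### Product densities and the averaging argument -/

/-- **Tonelli's theorem** for a product of functions of separate variables. -/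
theorem lintegral_fin_prod_eq_prod {n : ℕ} {E : Type*} [MeasurableSpace E] (μ : Measure E)
    [SigmaFinite μ] (f : Fin n → E → ℝ≥0∞) (hf : ∀ i, Measurable (f i)) :
    ∫⁻ x : Fin n → E, ∏ i, f i (x i) ∂(Measure.pi fun _ => μ) = ∏ i, ∫⁻ x, f i x ∂μ := by
  induction n with
  | zero => simp
  | succ n ih =>
    have h := (measurePreserving_piFinSuccAbove (fun _ : Fin (n + 1) => μ) 0).lintegral_comp_emb
      (MeasurableEquiv.measurableEmbedding _)
      (fun y : E × (Fin n → E) => f 0 y.1 * ∏ i : Fin n, f i.succ (y.2 i))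
    have hg : Measurable fun y : Fin n → E => ∏ i : Fin n, f i.succ (y i) :=
      Finset.measurable_prod _ fun i _ => (hf i.succ).comp (measurable_pi_apply i)
    rw [Fin.prod_univ_succ, ← ih _ fun i => hf i.succ,
      ← lintegral_prod_mul (hf 0).aemeasurable hg.aemeasurable]
    simp_rw [Fin.prod_univ_succ]
    exact h

/-- A product of measures with densities has the product density. -/
theorem pi_withDensity {n : ℕ} {E : Type*} [MeasurableSpace E] (μ : Measure E) [SigmaFinite μ]
    (f : E → ℝ≥0∞) (hf : Measurable f) [SigmaFinite (μ.withDensity f)] :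
    (Measure.pi fun _ : Fin n => μ.withDensity f) =
      (Measure.pi fun _ : Fin n => μ).withDensity fun x => ∏ i, f (x i) := by
  refine Measure.pi_eq fun s hs => ?_
  rw [withDensity_apply _ (MeasurableSet.univ_pi hs),
    ← lintegral_indicator (MeasurableSet.univ_pi hs)]
  calc _ = ∫⁻ x : Fin n → E, ∏ i, (s i).indicator f (x i) ∂(Measure.pi fun _ => μ) := by
        congr 1 with x
        by_cases hx : x ∈ Set.univ.pi s
        · rw [Set.indicator_of_mem hx]
          exact Finset.prod_congr rfl fun i _ => (Set.indicator_of_mem (hx i trivial) f).symm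
        · rw [Set.indicator_of_notMem hx]
          obtain ⟨i, hi⟩ : ∃ i, x i ∉ s i := by simpa [Set.mem_pi] using hx
          exact (Finset.prod_eq_zero (Finset.mem_univ i) (Set.indicator_of_notMem hi f)).symm
    _ = _ := by
        rw [lintegral_fin_prod_eq_prod μ _ fun i => hf.indicator (hs i)]
        exact Finset.prod_congr rfl fun i _ => by
          rw [lintegral_indicator (hs i), withDensity_apply _ (hs i)]

/-- If, for every observation `x`, the parameters are paired by an involution `flip x` which
preserves the likelihood and which never leaves both members of a pair outside their failure
sets, then the failure probabilities average to at least `1 / 2`. -/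
theorem card_le_two_mul_sum_measure {Ω Θ : Type*} [MeasurableSpace Ω] [Fintype Θ] (μ : Measure Ω)
    (f : Θ → Ω → ℝ≥0∞) (hf : ∀ θ, Measurable (f θ)) (hf1 : ∀ θ, ∫⁻ x, f θ x ∂μ = 1)
    (flip : Ω → Θ → Θ) (hflip : ∀ x, Function.Involutive (flip x))
    (hlik : ∀ x θ, f (flip x θ) x = f θ x)
    (A : Θ → Set Ω) (hA : ∀ x θ, x ∈ A θ ∨ x ∈ A (flip x θ)) :
    (Fintype.card Θ : ℝ≥0∞) ≤ 2 * ∑ θ, μ.withDensity (f θ) (A θ) := by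
  -- The failure sets may be non-measurable; measurable hulls have the same outer measure and keep
  -- the covering property.
  set B : Θ → Set Ω := fun θ => toMeasurable (μ.withDensity (f θ)) (A θ)
  have hB : ∀ θ, MeasurableSet (B θ) := fun θ => measurableSet_toMeasurable _ _
  have hBA : ∀ x θ, x ∈ B θ ∨ x ∈ B (flip x θ) := fun x θ =>
    (hA x θ).imp (fun h => subset_toMeasurable _ _ h) fun h => subset_toMeasurable _ _ h
  have hsum : ∑ θ, μ.withDensity (f θ) (A θ) = ∫⁻ x, ∑ θ, (B θ).indicator (f θ) x ∂μ := by
    rw [lintegral_finsetSum _ fun θ _ => (hf θ).indicator (hB θ)]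
    refine Finset.sum_congr rfl fun θ _ => ?_
    rw [lintegral_indicator (hB θ), ← withDensity_apply _ (hB θ), measure_toMeasurable]
  have hcard : (Fintype.card Θ : ℝ≥0∞) = ∫⁻ x, ∑ θ, f θ x ∂μ := by
    rw [lintegral_finsetSum _ fun θ _ => hf θ]
    simp [hf1]
  rw [hsum, hcard, ← lintegral_const_mul _
    (Finset.measurable_sum _ fun θ _ => (hf θ).indicator (hB θ))]
  refine lintegral_mono fun x => ?_
  -- For fixed `x`, the flip is a permutation of the parameters, so it only reindexes the sum.
  have hperm : ∑ θ, (B (flip x θ)).indicator (f (flip x θ)) x = ∑ θ, (B θ).indicator (f θ) x :=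
    Equiv.sum_comp (hflip x).toPerm fun θ => (B θ).indicator (f θ) x
  calc ∑ θ, f θ x
      ≤ ∑ θ, ((B θ).indicator (f θ) x + (B (flip x θ)).indicator (f (flip x θ)) x) := by
        refine Finset.sum_le_sum fun θ _ => ?_
        rcases hBA x θ with h | h
        · rw [Set.indicator_of_mem h]
          exact le_self_add
        · rw [Set.indicator_of_mem h, hlik]
          exact le_add_self
    _ = 2 * ∑ θ, (B θ).indicator (f θ) x := by
        rw [Finset.sum_add_distrib, hperm, two_mul]

/-! ### Bins and cells of the grid -/

theorem binHist_nonneg {b : ℕ} (i : Fin b) (x : ℝ) : 0 ≤ binHist b i x :=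
  Set.indicator_nonneg (fun _ _ => Nat.cast_nonneg b) x

theorem measurable_binHist {b : ℕ} (i : Fin b) : Measurable (binHist b i) :=
  measurable_const.indicator measurableSet_Ico

theorem binHist_ne_zero {b : ℕ} {i : Fin b} {x : ℝ} (h : binHist b i x ≠ 0) :
    x ∈ Set.Ico ((i : ℝ) / (b : ℝ)) (((i : ℝ) + 1) / (b : ℝ)) :=
  Set.mem_of_indicator_ne_zero h

theorem mem_Ico_of_binHist_ne_zero {b : ℕ} {i : Fin b} {x : ℝ} (h : binHist b i x ≠ 0) :
    x ∈ Set.Ico (0 : ℝ) 1 := by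
  obtain ⟨h1, h2⟩ := binHist_ne_zero h
  refine ⟨le_trans (by positivity) h1, h2.trans_le (div_le_one_of_le₀ ?_ (by positivity))⟩
  exact_mod_cast i.2

theorem eq_of_binHist_ne_zero {b : ℕ} {i j : Fin b} {x : ℝ} (hi : binHist b i x ≠ 0)
    (hj : binHist b j x ≠ 0) : i = j := by
  have hb : (0 : ℝ) < b := by exact_mod_cast i.pos
  obtain ⟨h1, h2⟩ := binHist_ne_zero hi
  obtain ⟨h3, h4⟩ := binHist_ne_zero hj
  have h5 := (div_lt_div_iff_of_pos_right hb).1 (h1.trans_lt h4)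
  have h6 := (div_lt_div_iff_of_pos_right hb).1 (h3.trans_lt h2)
  norm_cast at h5 h6
  exact Fin.ext (by omega)

theorem lintegral_binHist {b : ℕ} (i : Fin b) : ∫⁻ x, ENNReal.ofReal (binHist b i x) = 1 := by
  have hb : (0 : ℝ) < b := by exact_mod_cast i.pos
  have h : ∀ x, ENNReal.ofReal (binHist b i x) =
      (Set.Ico ((i : ℝ) / (b : ℝ)) (((i : ℝ) + 1) / (b : ℝ))).indicator
        (fun _ => ENNReal.ofReal b) x := by
    intro x
    unfold binHist
    by_cases hx : x ∈ Set.Ico ((i : ℝ) / (b : ℝ)) (((i : ℝ) + 1) / (b : ℝ)) <;> simp [hx]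
  simp_rw [h]
  rw [lintegral_indicator measurableSet_Ico, setLIntegral_const, Real.volume_Ico,
    ← ENNReal.ofReal_mul hb.le, ← ENNReal.ofReal_one]
  congr 1
  field_simp
  ring

/-- The uniform density on the cell of the grid with `b` bins per dimension that has the
index `κ`. -/
noncomputable def cellHist {d b : ℕ} (κ : Fin d → Fin b) (x : Fin d → ℝ) : ℝ :=
  ∏ j, binHist b (κ j) (x j)

theorem cellHist_nonneg {d b : ℕ} (κ : Fin d → Fin b) (x : Fin d → ℝ) : 0 ≤ cellHist κ x :=
  Finset.prod_nonneg fun _ _ => binHist_nonneg _ _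

theorem measurable_cellHist {d b : ℕ} (κ : Fin d → Fin b) : Measurable (cellHist κ) :=
  Finset.measurable_prod _ fun j _ => (measurable_binHist (κ j)).comp (measurable_pi_apply j)

theorem binHist_ne_zero_of_cellHist_ne_zero {d b : ℕ} {κ : Fin d → Fin b} {x : Fin d → ℝ}
    (h : cellHist κ x ≠ 0) (j : Fin d) : binHist b (κ j) (x j) ≠ 0 :=
  Finset.prod_ne_zero_iff.1 h j (Finset.mem_univ j)

theorem eq_of_cellHist_ne_zero {d b : ℕ} {κ τ : Fin d → Fin b} {x : Fin d → ℝ}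
    (hκ : cellHist κ x ≠ 0) (hτ : cellHist τ x ≠ 0) : κ = τ :=
  funext fun j => eq_of_binHist_ne_zero (binHist_ne_zero_of_cellHist_ne_zero hκ j)
    (binHist_ne_zero_of_cellHist_ne_zero hτ j)

theorem cellHist_eq_zero_of_notMem {d b : ℕ} (κ : Fin d → Fin b) {x : Fin d → ℝ}
    (hx : x ∉ unitCube d) : cellHist κ x = 0 := by
  by_contra h
  exact hx fun j _ => mem_Ico_of_binHist_ne_zero (binHist_ne_zero_of_cellHist_ne_zero h j)

theorem lintegral_cellHist {d b : ℕ} (κ : Fin d → Fin b) :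
    ∫⁻ x, ENNReal.ofReal (cellHist κ x) = 1 := by
  unfold cellHist
  simp_rw [ENNReal.ofReal_prod_of_nonneg fun j _ => binHist_nonneg (κ j) _]
  rw [volume_pi, lintegral_fin_prod_eq_prod volume (fun j y => ENNReal.ofReal (binHist b (κ j) y))
    fun j => (measurable_binHist (κ j)).ennreal_ofReal]
  simp [lintegral_binHist]

/-! ### Mixtures over pairs of cells, and the flip of unseen pairs -/

section CellMixture

variable {d b : ℕ} {C : Type*} (σ : C → Bool → Fin d → Fin b) (θ : C → Bool)

/-- A sum of `cellHist`s over a set of cells, weighted uniformly, has the expected mass. -/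
theorem lintegral_sum_cellHist (S : Finset C) (a : ℝ) (ha : 0 ≤ a) :
    ∫⁻ x, ENNReal.ofReal (∑ c ∈ S, a * cellHist (σ c (θ c)) x) = ENNReal.ofReal (S.card * a) := by
  simp_rw [ENNReal.ofReal_sum_of_nonneg fun c _ => mul_nonneg ha (cellHist_nonneg (σ c (θ c)) _),
    ENNReal.ofReal_mul ha]
  rw [lintegral_finsetSum _ fun c _ =>
    (measurable_cellHist (σ c (θ c))).ennreal_ofReal.const_mul _]
  simp_rw [lintegral_const_mul _ (measurable_cellHist (σ _ (θ _))).ennreal_ofReal,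
    lintegral_cellHist]
  rw [ENNReal.ofReal_mul (Nat.cast_nonneg _)]
  simp

/-- The cells of the pair `c` contain none of the sample points. -/
def IsUnseen {n : ℕ} (x : Fin n → Fin d → ℝ) (c : C) : Prop :=
  ∀ l t, cellHist (σ c t) (x l) = 0

open Classical in
/-- The choice of cells that differs from `θ` in exactly the pairs without sample points. -/
noncomputable def flipUnseen {n : ℕ} (x : Fin n → Fin d → ℝ) (θ : C → Bool) (c : C) : Bool :=
  if IsUnseen σ x c then !θ c else θ c

/-- Which pairs are flipped depends on the sample only, not on `θ`. -/
theorem flipUnseen_involutive {n : ℕ} (x : Fin n → Fin d → ℝ) :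
    Function.Involutive (flipUnseen σ x) := by
  intro θ
  funext c
  by_cases h : IsUnseen σ x c <;> simp [flipUnseen, h]

variable [Fintype C]

/-- The uniform mixture of the uniform densities on the cells `σ c (θ c)`. -/
noncomputable def cellMixture (x : Fin d → ℝ) : ℝ :=
  ∑ c, (Fintype.card C : ℝ)⁻¹ * cellHist (σ c (θ c)) x

theorem cellMixture_nonneg (x : Fin d → ℝ) : 0 ≤ cellMixture σ θ x :=
  Finset.sum_nonneg fun _ _ => mul_nonneg (by positivity) (cellHist_nonneg _ _)

theorem measurable_cellMixture : Measurable (cellMixture σ θ) :=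
  Finset.measurable_sum _ fun c _ => (measurable_cellHist (σ c (θ c))).const_mul _

theorem lintegral_cellMixture [Nonempty C] :
    ∫⁻ x, ENNReal.ofReal (cellMixture σ θ x) = 1 := by
  have h := lintegral_sum_cellHist σ θ Finset.univ (Fintype.card C : ℝ)⁻¹ (by positivity)
  rw [Finset.card_univ, mul_inv_cancel₀ (by exact_mod_cast Fintype.card_ne_zero),
    ENNReal.ofReal_one] at h
  exact h

theorem cellMixture_mem_densities [Nonempty C] : cellMixture σ θ ∈ densities d :=
  ⟨measurable_cellMixture σ θ, cellMixture_nonneg σ θ,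
    fun _ hx => Finset.sum_eq_zero fun _ _ => by rw [cellHist_eq_zero_of_notMem _ hx, mul_zero],
    lintegral_cellMixture σ θ⟩

/-- Flipped pairs contribute zero at every sample point, both before and after the flip. -/
theorem cellMixture_flipUnseen {n : ℕ} (x : Fin n → Fin d → ℝ) (l : Fin n) :
    cellMixture σ (flipUnseen σ x θ) (x l) = cellMixture σ θ (x l) := by
  refine Finset.sum_congr rfl fun c _ => ?_
  by_cases h : IsUnseen σ x c
  · rw [h l, h l]
  · simp [flipUnseen, h]

open Classical in
-- Distinct cells are disjoint, so each sample point meets at most one pair.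
theorem card_le_card_unseen_add (hσ : ∀ c t c' t', σ c t = σ c' t' → c = c' ∧ t = t')
    {n : ℕ} (x : Fin n → Fin d → ℝ) :
    Fintype.card C ≤ (Finset.univ.filter (IsUnseen σ x)).card + n := by
  rw [← Finset.card_univ, ← Finset.card_filter_add_card_filter_not (IsUnseen σ x)]
  refine Nat.add_le_add_left ?_ _
  calc _ ≤ (Finset.univ : Finset (Fin n)).card := by
        refine Finset.card_le_card_of_forall_subsingleton
          (fun c l => ∃ t, cellHist (σ c t) (x l) ≠ 0) (fun c hc => ?_) ?_
        · have hc' := (Finset.mem_filter.1 hc).2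
          unfold IsUnseen at hc'
          push Not at hc'
          obtain ⟨l, t, h⟩ := hc'
          exact ⟨l, Finset.mem_univ l, t, h⟩
        · rintro l - c ⟨-, t, ht⟩ c' ⟨-, t', ht'⟩
          exact (hσ _ _ _ _ (eq_of_cellHist_ne_zero ht ht')).1
    _ = n := Finset.card_fin n

open Classical in
theorem sum_unseen_le_abs_sub (hσ : ∀ c t c' t', σ c t = σ c' t' → c = c' ∧ t = t')
    {n : ℕ} (x : Fin n → Fin d → ℝ) (y : Fin d → ℝ) :
    ∑ c ∈ Finset.univ.filter (IsUnseen σ x), (Fintype.card C : ℝ)⁻¹ * cellHist (σ c (θ c)) y ≤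
      |cellMixture σ θ y - cellMixture σ (flipUnseen σ x θ) y| := by
  by_cases h : ∀ c ∈ Finset.univ.filter (IsUnseen σ x),
      (Fintype.card C : ℝ)⁻¹ * cellHist (σ c (θ c)) y = 0
  · rw [Finset.sum_eq_zero h]
    exact abs_nonneg _
  push Not at h
  obtain ⟨c, hc, hcy⟩ := h
  have hcy' := right_ne_zero_of_mul hcy
  -- Here `y` lies in the chosen cell of an unseen pair, and the flipped mixture puts no mass on
  -- that cell.
  have hzero : cellMixture σ (flipUnseen σ x θ) y = 0 := by
    refine Finset.sum_eq_zero fun c' _ => ?_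
    by_contra h'
    obtain ⟨rfl, ht⟩ := hσ _ _ _ _ (eq_of_cellHist_ne_zero hcy' (right_ne_zero_of_mul h'))
    simp [flipUnseen, (Finset.mem_filter.1 hc).2] at ht
  rw [hzero, sub_zero, abs_of_nonneg (cellMixture_nonneg σ θ y)]
  exact Finset.sum_le_sum_of_subset_of_nonneg (Finset.filter_subset _ _)
    fun _ _ _ => mul_nonneg (by positivity) (cellHist_nonneg _ _)

theorem half_le_l1dist_flipUnseen [Nonempty C]
    (hσ : ∀ c t c' t', σ c t = σ c' t' → c = c' ∧ t = t') {n : ℕ}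
    (hn : 2 * n ≤ Fintype.card C) (x : Fin n → Fin d → ℝ) :
    ENNReal.ofReal (1 / 2) ≤ l1dist (cellMixture σ θ) (cellMixture σ (flipUnseen σ x θ)) := by
  classical
  have hC : (0 : ℝ) < Fintype.card C := by exact_mod_cast Fintype.card_pos
  -- Each unseen pair contributes mass `1 / N` through its cell chosen by `θ`; the cell chosen after
  -- the flip is not counted.
  refine le_trans ?_ (lintegral_mono fun y =>
    ENNReal.ofReal_le_ofReal (sum_unseen_le_abs_sub σ θ hσ x y))
  rw [lintegral_sum_cellHist σ θ _ _ (by positivity)]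
  refine ENNReal.ofReal_le_ofReal ?_
  rw [← div_eq_mul_inv, le_div_iff₀ hC]
  have h1 := card_le_card_unseen_add σ hσ x
  have h2 : Fintype.card C ≤ 2 * (Finset.univ.filter (IsUnseen σ x)).card := by omega
  have h3 : (Fintype.card C : ℝ) ≤ 2 * ((Finset.univ.filter (IsUnseen σ x)).card : ℝ) := by
    exact_mod_cast h2
  linarith

end CellMixture

/-! ### The lower bound for a class that contains all the mixtures -/

theorem l1dist_triangle {d : ℕ} {f g h : (Fin d → ℝ) → ℝ} (hf : Measurable f)
    (hg : Measurable g) : l1dist f h ≤ l1dist g f + l1dist g h := by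
  unfold l1dist
  have hgf : Measurable fun x => ENNReal.ofReal |g x - f x| := by fun_prop
  rw [← lintegral_add_left hgf]
  refine lintegral_mono fun x => ?_
  rw [← ENNReal.ofReal_add (abs_nonneg _) (abs_nonneg _)]
  refine ENNReal.ofReal_le_ofReal ?_
  rw [abs_sub_comm (g x)]
  exact abs_sub_le _ _ _

theorem measurable_of_mem_histograms1 {b : ℕ} {f : ℝ → ℝ} (hf : f ∈ histograms1 b) :
    Measurable f := by
  have hconv : Convex ℝ {f : ℝ → ℝ | Measurable f} := fun f hf g hg s t _ _ _ =>
    Measurable.add (Measurable.const_smul hf s) (Measurable.const_smul hg t)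
  refine convexHull_min ?_ hconv hf
  rintro _ ⟨i, rfl⟩
  exact measurable_binHist i

theorem measurable_of_mem_multiViewHistograms {d b k : ℕ} {g : (Fin d → ℝ) → ℝ}
    (hg : g ∈ multiViewHistograms d b k) : Measurable g := by
  obtain ⟨w, -, f, hf, rfl⟩ := hg
  exact Finset.measurable_sum _ fun i _ => (Finset.measurable_prod _ fun j _ =>
    (measurable_of_mem_histograms1 (hf i j)).comp (measurable_pi_apply j)).const_mul _

/-- If a class `Q` contains all uniform mixtures of choices from `N` pairs of cells, then an
estimator with measurable values fails on some density with probability at least `1 / 2`, unless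
the sample size is more than `N / 2`. -/
theorem half_le_worstFailureProb {d b n : ℕ} {C : Type*} [Fintype C] [Nonempty C]
    (σ : C → Bool → Fin d → Fin b) (hσ : ∀ c t c' t', σ c t = σ c' t' → c = c' ∧ t = t')
    (hn : 2 * n ≤ Fintype.card C) (Q : Set ((Fin d → ℝ) → ℝ)) (hQ : ∀ θ, cellMixture σ θ ∈ Q)
    (V : (Fin n → Fin d → ℝ) → (Fin d → ℝ) → ℝ) (hV : ∀ x, Measurable (V x)) :
    1 / 2 ≤ worstFailureProb V Q (1 / 8) := by
  classical
  set F : (C → Bool) → Set (Fin n → Fin d → ℝ) := fun θ =>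
    {x | l1dist (V x) (cellMixture σ θ) > 3 * (⨅ q ∈ Q, l1dist (cellMixture σ θ) q) +
      ENNReal.ofReal (1 / 8)} with hF
  have hinf : ∀ θ, ⨅ q ∈ Q, l1dist (cellMixture σ θ) q = 0 := fun θ =>
    le_antisymm ((iInf₂_le _ (hQ θ)).trans (by simp [l1dist])) zero_le
  set f : (C → Bool) → (Fin d → ℝ) → ℝ≥0∞ := fun θ y => ENNReal.ofReal (cellMixture σ θ y)
    with hf_def
  have hf : ∀ θ, Measurable (f θ) := fun θ => (measurable_cellMixture σ θ).ennreal_ofReal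
  have hlaw : ∀ θ, sampleLaw n (cellMixture σ θ) =
      (Measure.pi fun _ : Fin n => volume).withDensity fun x => ∏ l, f θ (x l) := by
    intro θ
    have : IsFiniteMeasure ((volume : Measure (Fin d → ℝ)).withDensity (f θ)) :=
      isFiniteMeasure_withDensity (by simp [hf_def, lintegral_cellMixture])
    exact pi_withDensity volume (f θ) (hf θ)
  have hprod : ∀ θ, Measurable fun x : Fin n → Fin d → ℝ => ∏ l, f θ (x l) := fun θ =>
    Finset.measurable_prod _ fun l _ => (hf θ).comp (measurable_pi_apply l)
  have key := card_le_two_mul_sum_measure (Measure.pi fun _ : Fin n => volume)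
    (fun θ (x : Fin n → Fin d → ℝ) => ∏ l, f θ (x l)) hprod
    (fun θ => by
      rw [lintegral_fin_prod_eq_prod volume (fun _ => f θ) fun _ => hf θ]
      simp [hf_def, lintegral_cellMixture])
    (flipUnseen σ) (flipUnseen_involutive σ)
    (fun x θ => by simp [hf_def, cellMixture_flipUnseen]) F
    (fun x θ => by
      by_contra hcon
      simp only [hF, hinf, Set.mem_ofPred_eq, mul_zero, zero_add, gt_iff_lt, not_or, not_lt]
        at hcon
      -- Success at both `θ` and its flip would give `1 / 2 ≤ 1 / 8 + 1 / 8`.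
      have h := (half_le_l1dist_flipUnseen σ θ hσ hn x).trans
        ((l1dist_triangle (measurable_cellMixture σ θ) (hV x)).trans
          (add_le_add hcon.1 hcon.2))
      rw [← ENNReal.ofReal_add (by norm_num) (by norm_num),
        ENNReal.ofReal_le_ofReal_iff (by norm_num)] at h
      norm_num at h)
  have hle : ∀ θ, ((Measure.pi fun _ : Fin n => volume).withDensity
      fun x => ∏ l, f θ (x l)) (F θ) ≤ worstFailureProb V Q (1 / 8) := by
    intro θ
    rw [← hlaw]
    exact le_iSup₂ (f := fun p (_ : p ∈ densities d) => sampleLaw n p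
      {x | l1dist (V x) p > 3 * (⨅ q ∈ Q, l1dist p q) + ENNReal.ofReal (1 / 8)})
      (cellMixture σ θ) (cellMixture_mem_densities σ θ)
  have hsum := key.trans (mul_le_mul_right (Finset.sum_le_sum fun θ _ => hle θ) 2)
  rw [Finset.sum_const, Finset.card_univ, nsmul_eq_mul, mul_left_comm] at hsum
  have h1 : (1 : ℝ≥0∞) ≤ 2 * worstFailureProb V Q (1 / 8) := by
    refine (ENNReal.mul_le_mul_iff_right (a := (Fintype.card (C → Bool) : ℝ≥0∞)) ?_
      (ENNReal.natCast_ne_top _)).1 (by rwa [mul_one])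
    exact_mod_cast Fintype.card_ne_zero
  exact ENNReal.div_le_of_le_mul' h1

/-! ### Mixtures that are multi-view histograms -/

theorem sum_smul_binHist_mem_histograms1 {b m : ℕ} [NeZero m] (τ : Fin m → Fin b) :
    ∑ j, (m : ℝ)⁻¹ • binHist b (τ j) ∈ histograms1 b := by
  refine (convex_convexHull ℝ _).sum_mem (fun _ _ => by positivity) ?_
    fun j _ => subset_convexHull ℝ _ (Set.mem_range_self (τ j))
  simp [NeZero.ne m]

/-- Pairs of cells: the cells that are paired agree in all coordinates but the second one, where
they have neighbouring bins. -/
def pairedCell {d b k : ℕ} (hkb : k ≤ b) (c : Fin k × Fin (b / 2)) (t : Bool) (j : Fin d) :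
    Fin b :=
  if j.val = 1 then ⟨2 * c.2.val + t.toNat, by have := t.toNat_lt; omega⟩
  else Fin.castLE hkb c.1

/-- Coordinate `0` recovers `c.1`; coordinate `1` recovers `c.2` as the half and `t` as the parity.
-/
theorem pairedCell_injective {d b k : ℕ} (hd : 2 ≤ d) (hkb : k ≤ b) (c : Fin k × Fin (b / 2))
    (t : Bool) (c' : Fin k × Fin (b / 2)) (t' : Bool)
    (h : pairedCell (d := d) hkb c t = pairedCell hkb c' t') : c = c' ∧ t = t' := by
  have h0 := congrArg Fin.val (congrFun h ⟨0, by omega⟩)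
  have h1 := congrArg Fin.val (congrFun h ⟨1, by omega⟩)
  simp only [pairedCell, zero_ne_one, if_false, if_true, Fin.val_castLE] at h0 h1
  refine ⟨Prod.ext (Fin.ext h0) (Fin.ext ?_), ?_⟩ <;> cases t <;> cases t' <;>
    simp at h1 ⊢ <;> omega

/-- Cells with the same `c.1 = i` differ in the second coordinate only, so their mixture is a single
product. This leaves `k` separable terms. -/
theorem cellMixture_pairedCell_mem {d b k : ℕ} [NeZero k] [NeZero (b / 2)] (hd : 2 ≤ d)
    (hkb : k ≤ b) (θ : Fin k × Fin (b / 2) → Bool) :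
    cellMixture (pairedCell hkb) θ ∈ multiViewHistograms d b k := by
  set j₁ : Fin d := ⟨1, by omega⟩ with hj₁
  have hne : ∀ j ∈ ({j₁}ᶜ : Finset (Fin d)), j.val ≠ 1 := by
    intro j hj h
    exact (by simpa using hj : j ≠ j₁) (Fin.ext h)
  set τ : Fin k → Fin (b / 2) → Fin b := fun i m =>
    ⟨2 * m.val + (θ (i, m)).toNat, by have := (θ (i, m)).toNat_lt; omega⟩
  refine ⟨fun _ => (k : ℝ)⁻¹, ⟨fun _ => by positivity, by simp [NeZero.ne k]⟩,
    fun i j => if j.val = 1 then ∑ m, ((b / 2 : ℕ) : ℝ)⁻¹ • binHist b (τ i m)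
      else binHist b (Fin.castLE hkb i), fun i j => ?_, ?_⟩
  · dsimp only
    split_ifs
    · exact sum_smul_binHist_mem_histograms1 (τ i)
    · exact subset_convexHull ℝ _ (Set.mem_range_self _)
  · funext x
    have hcell : ∀ i m, cellHist (pairedCell hkb (i, m) (θ (i, m))) x =
        binHist b (τ i m) (x j₁) *
          ∏ j ∈ ({j₁}ᶜ : Finset (Fin d)), binHist b (Fin.castLE hkb i) (x j) := by
      intro i m
      unfold cellHist
      rw [Fintype.prod_eq_mul_prod_compl j₁]
      congr 1
      exact Finset.prod_congr rfl fun j hj => by simp [pairedCell, hne j hj]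
    unfold cellMixture
    rw [Fintype.sum_prod_type]
    refine Finset.sum_congr rfl fun i _ => ?_
    dsimp only
    have hrest : ∀ j ∈ ({j₁}ᶜ : Finset (Fin d)),
        (if j.val = 1 then ∑ m, ((b / 2 : ℕ) : ℝ)⁻¹ • binHist b (τ i m)
          else binHist b (Fin.castLE hkb i)) (x j) = binHist b (Fin.castLE hkb i) (x j) :=
      fun j hj => by rw [if_neg (hne j hj)]
    rw [Fintype.prod_eq_mul_prod_compl j₁, Finset.prod_congr rfl hrest]
    simp only [hcell, hj₁, if_true, Finset.sum_apply, Pi.smul_apply, smul_eq_mul,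
      Finset.sum_mul, Finset.mul_sum, Fintype.card_prod, Fintype.card_fin, Nat.cast_mul, mul_inv]
    exact Finset.sum_congr rfl fun m _ => by ring

end NNTF

theorem mainTheorem4 (d : ℕ) (hd : 2 ≤ d) (b k : ℕ → ℕ)
    (hb : Tendsto b atTop atTop) (hk : Tendsto k atTop atTop)
    (hkb : ∀ᶠ n in atTop, k n ≤ b n)
    (hn : Tendsto (fun n : ℕ => (n : ℝ) / ((b n : ℝ) * (k n : ℝ))) atTop (𝓝 0)) :
    ¬ ∃ V : (n : ℕ) → (Fin n → Fin d → ℝ) → ((Fin d → ℝ) → ℝ),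
      (∀ᶠ n in atTop, ∀ x, V n x ∈ NNTF.multiViewHistograms d (b n) (k n)) ∧
      ∀ ε : ℝ, 0 < ε →
        Tendsto (fun n => NNTF.worstFailureProb (V n)
          (NNTF.multiViewHistograms d (b n) (k n)) ε) atTop (𝓝 0) := by
  rintro ⟨V, hV, hlim⟩
  have hsmall := (hlim (1 / 8) (by norm_num)).eventually_lt_const
    (show (0 : ℝ≥0∞) < 1 / 2 by simp)
  have hratio := hn.eventually_lt_const (show (0 : ℝ) < 1 / 8 by norm_num)
  obtain ⟨n, hlt, hVn, hkbn, hbn, hkn, hr⟩ := (hsmall.and <| hV.and <| hkb.and <|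
    (hb.eventually_ge_atTop 2).and <| (hk.eventually_ge_atTop 1).and hratio).exists
  have : NeZero (k n) := ⟨by omega⟩
  have : NeZero (b n / 2) := ⟨by omega⟩
  have hpos : (0 : ℝ) < (b n : ℝ) * (k n : ℝ) := by
    have : 0 < b n * k n := Nat.mul_pos (by omega) (by omega)
    exact_mod_cast this
  have hcard : 2 * n ≤ Fintype.card (Fin (k n) × Fin (b n / 2)) := by
    rw [div_lt_iff₀ hpos] at hr
    have h8 : (8 * n : ℝ) < b n * k n := by linarith
    have h8' : 8 * n < b n * k n := by exact_mod_cast h8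
    -- `b ≤ 4 * (b / 2)` holds under floor division because `2 ≤ b`; this is why the ratio is taken
    -- below `1 / 8`.
    have hb4 : b n * k n ≤ 4 * (b n / 2) * k n := Nat.mul_le_mul_right _ (by omega)
    rw [Fintype.card_prod, Fintype.card_fin, Fintype.card_fin]
    nlinarith
  exact absurd (NNTF.half_le_worstFailureProb (NNTF.pairedCell hkbn)
    (NNTF.pairedCell_injective hd hkbn) hcard _ (NNTF.cellMixture_pairedCell_mem hd hkbn) (V n)
    fun x => NNTF.measurable_of_mem_multiViewHistograms (hVn x)) (not_le.2 hlt)
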